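/- Let $(X,d_X)$ and $(Y,d_Y)$ be compact metric spaces and let $\mu\in\mathcal M_+(X)$, $\nu\in\mathcal M_+(Y)$, where $\mathcal M_+$ denotes the set of finite positive Borel measures. Let $\varphi:\mathbb R_+\to[0,+\infty]$ be an entropy function, i.e. convex and lower semicontinuous with $\varphi(1)=0$, and let $\varphi'_\infty=\lim_{r\to\infty}\varphi(r)/r\in[0,+\infty]$. For finite positive measures $\alpha,\beta$ on the same space, with Lebesgue decomposition $\alpha=\frac{d\alpha}{d\beta}\beta+\alpha^\perp$, put $$D_\varphi(\alpha|\beta)=\int\varphi\Big(\frac{d\alpha}{d\beta}\Big)\,d\beta+\varphi'_\infty\int d\alpha^\perp\quad(\infty\cdot 0=0),\qquad D_\varphi^\otimes(\alpha|\beta)=D_\varphi(\alpha\otimes\alpha\,|\,\beta\otimes\beta).$$ Let $\Delta$ be a distance on $\mathbb R_+$ and $\lambda:\mathbb R_+\to(-\infty,+\infty]$ a function such that $(a,b)\mapsto\lambda(\Delta(a,b))$ is lower semicontinuous on $\mathbb R_+^2$ for the usual topology (for example, $\Delta$ continuous and $\lambda$ lower semicontinuous). For $\pi\in\mathcal M_+(X\times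 Y)$ with marginals $\pi_1,\pi_2$ let $$\mathcal L(\pi)=\int\!\!\int\lambda\big(\Delta(d_X(x,x'),d_Y(y,y'))\big)\,d\pi(x,y)\,d\pi(x',y')+D_\varphi^\otimes(\pi_1|\mu)+D_\varphi^\otimes(\pi_2|\nu).$$ Suppose that either (i) $\varphi$ is superlinear, i.e. $\varphi'_\infty=+\infty$, or (ii) for every $c\in\mathbb R$ the sublevel set $\{t\in\mathbb R_+:\lambda(t)\le c\}$ is compact, and $2\varphi'_\infty+\inf_{\mathbb R_+}\lambda>0$. Then there exists $\pi\in\mathcal M_+(X\times Y)$ such that $$\mathcal L(\pi)=\inf_{\pi'\in\mathcal M_+(X\times Y)}\mathcal L(\pi').$$ -/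

import Mathlib

open MeasureTheory Filter Topology
open scoped NNReal ENNReal

noncomputable section

namespace UGW

/-- An entropy function `φ : ℝ₊ → [0, +∞]`: convex, lower semicontinuous, with `φ 1 = 0`. -/
structure IsEntropy (φ : ℝ≥0 → ℝ≥0∞) : Prop where
  convex : ConvexOn ℝ≥0 Set.univ φ
  lsc : LowerSemicontinuous φ
  map_one : φ 1 = 0

/-- The recession constant `φ'_∞ = lim_{r → ∞} φ(r) / r`. It is written as an upper limit, so that
it is defined for every `φ`; for an entropy function the limit exists,
see `IsEntropy.tendsto_recession`. -/
def recession (φ : ℝ≥0 → ℝ≥0∞) : ℝ≥0∞ :=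
  limsup (fun r : ℝ≥0 => φ r / (r : ℝ≥0∞)) atTop

/-- The Csiszár divergence `D_φ(μ|ν) = ∫ φ(dμ/dν) dν + φ'_∞ μ^⊥(Ω)`, where
`μ = (dμ/dν) ν + μ^⊥` is the Lebesgue decomposition; the convention is `∞ * 0 = 0`. -/
def csiszar {Ω : Type*} [MeasurableSpace Ω] (φ : ℝ≥0 → ℝ≥0∞) (μ ν : Measure Ω) : ℝ≥0∞ :=
  ∫⁻ x, φ (μ.rnDeriv ν x).toNNReal ∂ν + recession φ * μ.singularPart ν Set.univ

/-- The quadratic divergence `D_φ^⊗(ρ|ν) = D_φ(ρ ⊗ ρ | ν ⊗ ν)`. -/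
def quadCsiszar {Ω : Type*} [MeasurableSpace Ω] (φ : ℝ≥0 → ℝ≥0∞) (ρ ν : Measure Ω) : ℝ≥0∞ :=
  csiszar φ (ρ.prod ρ) (ν.prod ν)

/-- `Δ` is a distance on `ℝ₊`. -/
structure IsDistance (Δ : ℝ≥0 → ℝ≥0 → ℝ≥0) : Prop where
  eq_zero_iff : ∀ a b, Δ a b = 0 ↔ a = b
  symm : ∀ a b, Δ a b = Δ b a
  triangle : ∀ a b c, Δ a c ≤ Δ a b + Δ b c

/-- The integral of an extended-real-valued function: the integral of the positive part minus the
integral of the negative part. -/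
def integralEReal {Ω : Type*} [MeasurableSpace Ω] (f : Ω → EReal) (μ : Measure Ω) : EReal :=
  ((∫⁻ x, (f x).toENNReal ∂μ : ℝ≥0∞) : EReal) - ((∫⁻ x, (-f x).toENNReal ∂μ : ℝ≥0∞) : EReal)

/-- The distortion kernel `Γ(x, x', y, y') = Δ(d_X(x, x'), d_Y(y, y'))`, as a function of the pair
`((x, y), (x', y'))`. -/
def distortion {X Y : Type*} [MetricSpace X] [MetricSpace Y] (Δ : ℝ≥0 → ℝ≥0 → ℝ≥0)
    (z : (X × Y) × (X × Y)) : ℝ≥0 :=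
  Δ (nndist z.1.1 z.2.1) (nndist z.1.2 z.2.2)

/-- The functional `𝓛(π) = ∫ lam(Γ) dπ dπ + D_φ^⊗(π₁|μ) + D_φ^⊗(π₂|ν)`. -/
def functional {X Y : Type*} [MetricSpace X] [MeasurableSpace X] [MetricSpace Y]
    [MeasurableSpace Y] (φ : ℝ≥0 → ℝ≥0∞) (lam : ℝ≥0 → EReal) (Δ : ℝ≥0 → ℝ≥0 → ℝ≥0)
    (μ : Measure X) (ν : Measure Y) (π : Measure (X × Y)) : EReal :=
  integralEReal (fun z => lam (distortion Δ z)) (π.prod π)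
    + (quadCsiszar φ π.fst μ : EReal) + (quadCsiszar φ π.snd ν : EReal)

/-- The unbalanced Gromov-Wasserstein divergence: the infimum of the functional over all finite
positive measures on `X × Y`. -/
def ugw {X Y : Type*} [MetricSpace X] [MeasurableSpace X] [MetricSpace Y]
    [MeasurableSpace Y] (φ : ℝ≥0 → ℝ≥0∞) (lam : ℝ≥0 → EReal) (Δ : ℝ≥0 → ℝ≥0 → ℝ≥0)
    (μ : Measure X) (ν : Measure Y) : EReal :=
  ⨅ π : FiniteMeasure (X × Y), functional φ lam Δ μ ν (π : Measure (X × Y))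

theorem IsEntropy.slope_mono {φ : ℝ≥0 → ℝ≥0∞} (h : IsEntropy φ) {s r : ℝ≥0} (hs : 1 < s)
    (hr : s ≤ r) : φ s / ((s - 1 : ℝ≥0) : ℝ≥0∞) ≤ φ r / ((r - 1 : ℝ≥0) : ℝ≥0∞) := by
  obtain ⟨a, rfl⟩ := exists_add_of_le hs.le
  obtain ⟨b, rfl⟩ := exists_add_of_le (hs.le.trans hr)
  have ha : 0 < a := by simpa using hs
  have hab : a ≤ b := by simpa using hr
  have hb : 0 < b := ha.trans_le hab
  have hle : a / b ≤ 1 := (div_le_one₀ hb).2 hab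
  have hc := h.convex.2 (Set.mem_univ 1) (Set.mem_univ (1 + b)) (zero_le (a := 1 - a / b))
    (zero_le (a := a / b)) (tsub_add_cancel_of_le hle)
  have e : (1 - a / b) • (1 : ℝ≥0) + (a / b) • (1 + b) = 1 + a := by
    simp only [smul_eq_mul, mul_one, mul_add, ← add_assoc]
    rw [tsub_add_cancel_of_le hle, div_mul_cancel₀ _ hb.ne']
  rw [e, h.map_one, smul_zero, zero_add] at hc
  have ha' : (a : ℝ≥0∞) ≠ 0 := by simpa using ha.ne'
  simp only [add_tsub_cancel_left]
  rw [ENNReal.div_le_iff ha' ENNReal.coe_ne_top]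
  refine hc.trans_eq ?_
  rw [ENNReal.smul_def, smul_eq_mul, ENNReal.coe_div hb.ne']
  simp only [div_eq_mul_inv]
  ring

/-- For an entropy function the limit that defines the recession constant exists. -/
theorem IsEntropy.tendsto_recession {φ : ℝ≥0 → ℝ≥0∞} (h : IsEntropy φ) :
    Tendsto (fun r : ℝ≥0 => φ r / (r : ℝ≥0∞)) atTop (𝓝 (recession φ)) := by
  refine tendsto_of_le_liminf_of_limsup_le ?_ le_rfl
  -- every slope with base point `1` is a lower bound of the lower limit
  have key : ∀ s : ℝ≥0, 1 < s → φ s / ((s - 1 : ℝ≥0) : ℝ≥0∞) ≤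
      liminf (fun r : ℝ≥0 => φ r / (r : ℝ≥0∞)) atTop := by
    intro s hs
    have ht : Tendsto (fun r : ℝ≥0 => (φ s / ((s - 1 : ℝ≥0) : ℝ≥0∞)) * (1 - (r : ℝ≥0∞)⁻¹)) atTop
        (𝓝 (φ s / ((s - 1 : ℝ≥0) : ℝ≥0∞) * (1 - 0))) := by
      refine ENNReal.Tendsto.const_mul ?_ (Or.inl (by simp))
      refine ENNReal.Tendsto.sub tendsto_const_nhds ?_ (Or.inl ENNReal.one_ne_top)
      rw [← ENNReal.inv_top]
      exact (tendsto_inv_iff.2 (ENNReal.tendsto_coe_nhds_top.2 tendsto_id))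
    rw [tsub_zero, mul_one] at ht
    rw [← ht.liminf_eq]
    refine liminf_le_liminf ?_
    filter_upwards [eventually_ge_atTop s] with r hr
    refine (mul_le_mul_left (h.slope_mono hs hr) _).trans ?_
    have hr1 : 1 < r := hs.trans_le hr
    have hr0 : (r : ℝ≥0∞) ≠ 0 := by simpa using (zero_lt_one.trans hr1).ne'
    have hr2 : ((r - 1 : ℝ≥0) : ℝ≥0∞) ≠ 0 := ENNReal.coe_ne_zero.2 (tsub_pos_of_lt hr1).ne'
    have e : (1 - (r : ℝ≥0∞)⁻¹) = ((r - 1 : ℝ≥0) : ℝ≥0∞) * (r : ℝ≥0∞)⁻¹ := by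
      rw [ENNReal.coe_sub, ENNReal.sub_mul (fun _ _ => by simp [hr0]),
        ENNReal.mul_inv_cancel hr0 ENNReal.coe_ne_top]
      simp
    rw [e, ← mul_assoc, ENNReal.div_mul_cancel hr2 ENNReal.coe_ne_top, div_eq_mul_inv]
  refine limsup_le_of_le (by isBoundedDefault) ?_
  filter_upwards [eventually_gt_atTop (1 : ℝ≥0)] with r hr
  refine le_trans ?_ (key r hr)
  exact ENNReal.div_le_div_left (by exact_mod_cast tsub_le_self) _

end UGW

end

/-!
Fenchel–Moreau duality writes an entropy function, together with its recession constant, as a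
supremum of affine functions. Choosing one affine minorant on each cell of a measurable partition
and smoothing the choice by Lusin approximation, one obtains `D_φ(α|β)` as a supremum of
`∫ f₁ dα - ∫ f₂ dβ` over bounded continuous maps `(f₁, f₂)` into the convex set of affine minorants,
so it is weakly lower semicontinuous in `α`. Since `π ↦ π ⊗ π` is weakly continuous, the whole
functional is lower semicontinuous.

A constant affine minorant `r ↦ a * r - b` of slope `a` close to `φ'_∞` bounds the functional below
by `(2 * a + inf c) * m(π) ^ 2` up to an additive constant, where `m(π)` is the mass. The positivity
of `2 * φ'_∞ + inf c` makes this coercive in the mass, and sets of measures of bounded mass on a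
compact space are weakly compact, so the direct method applies.
-/

noncomputable section

open TopologicalSpace
open scoped BoundedContinuousFunction

namespace UGW

section AffineMinorants

variable {φ : ℝ≥0 → ℝ≥0∞}

/-- The pairs `(a, b)` such that the affine function `r ↦ a * r - b` lies below `φ`: the
epigraph of the Legendre conjugate of `φ`. -/
def affineMinorants (φ : ℝ≥0 → ℝ≥0∞) : Set (ℝ × ℝ) :=
  {p | ∀ r : ℝ≥0, ENNReal.ofReal (p.1 * r - p.2) ≤ φ r}

theorem zero_mem_affineMinorants (φ : ℝ≥0 → ℝ≥0∞) : (0 : ℝ × ℝ) ∈ affineMinorants φ := by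
  simp [affineMinorants]

theorem mem_affineMinorants_iff {p : ℝ × ℝ} :
    p ∈ affineMinorants φ ↔ ∀ r t : ℝ≥0, φ r ≤ t → p.1 * r - p.2 ≤ t := by
  refine forall_congr' fun r => ?_
  cases φ r with
  | top => simp
  | coe s =>
    rw [ENNReal.ofReal, ENNReal.coe_le_coe, Real.toNNReal_le_iff_le_coe]
    exact ⟨fun h t ht => h.trans (by exact_mod_cast ht), fun h => h s le_rfl⟩

theorem convex_affineMinorants (φ : ℝ≥0 → ℝ≥0∞) : Convex ℝ (affineMinorants φ) := by
  intro p hp q hq a b ha hb hab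
  rw [mem_affineMinorants_iff] at *
  intro r t hrt
  calc (a • p + b • q).1 * r - (a • p + b • q).2
      = a * (p.1 * r - p.2) + b * (q.1 * r - q.2) := by
        simp only [Prod.fst_add, Prod.snd_add, Prod.smul_fst, Prod.smul_snd, smul_eq_mul]
        ring
    _ ≤ a * t + b * t := by gcongr; exacts [hp r t hrt, hq r t hrt]
    _ = t := by rw [← add_mul, hab, one_mul]

/-- The epigraph of `φ`, as a subset of the real plane. -/
def realEpigraph (φ : ℝ≥0 → ℝ≥0∞) : Set (ℝ × ℝ) :=
  (Prod.map (↑) (↑) : ℝ≥0 × ℝ≥0 → ℝ × ℝ) '' {q | φ q.1 ≤ q.2}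

theorem IsEntropy.isClosed_realEpigraph (hφ : IsEntropy φ) : IsClosed (realEpigraph φ) := by
  have hcoe : IsClosedEmbedding ((↑) : ℝ≥0 → ℝ) := NNReal.isClosedEmbedding_coe
  exact (hcoe.prodMap hcoe).isClosedMap _ (hφ.lsc.isClosed_epigraph.preimage
    (f := fun q : ℝ≥0 × ℝ≥0 => (q.1, (q.2 : ℝ≥0∞))) (by fun_prop))

theorem IsEntropy.convex_realEpigraph (hφ : IsEntropy φ) : Convex ℝ (realEpigraph φ) := by
  rintro _ ⟨⟨r, t⟩, hrt, rfl⟩ _ ⟨⟨r', t'⟩, hrt', rfl⟩ a b ha hb hab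
  lift a to ℝ≥0 using ha
  lift b to ℝ≥0 using hb
  refine ⟨(a • r + b • r', a • t + b • t'), ?_, by simp⟩
  calc φ (a • r + b • r')
      ≤ a • φ r + b • φ r' :=
        hφ.convex.2 trivial trivial zero_le zero_le (by exact_mod_cast hab)
    _ ≤ a • (t : ℝ≥0∞) + b • (t' : ℝ≥0∞) := by gcongr; exacts [hrt, hrt']
    _ = ((a • t + b • t' : ℝ≥0) : ℝ≥0∞) := by simp [ENNReal.smul_def]

theorem IsEntropy.exists_separation (hφ : IsEntropy φ) {r₀ c : ℝ≥0} (hc : c < φ r₀) :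
    ∃ A B u : ℝ, 0 < B ∧ A * r₀ + B * c < u ∧ ∀ r t : ℝ≥0, φ r ≤ t → u ≤ A * r + B * t := by
  have hnot : ((r₀ : ℝ), (c : ℝ)) ∉ realEpigraph φ := by
    rintro ⟨⟨r, t⟩, hrt, heq⟩
    obtain ⟨rfl, rfl⟩ : r = r₀ ∧ t = c := by simpa using heq
    exact hc.not_ge hrt
  obtain ⟨f, u, hfu, huf⟩ := geometric_hahn_banach_point_closed hφ.convex_realEpigraph
    hφ.isClosed_realEpigraph hnot
  set A := f (1, 0)
  set B := f (0, 1)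
  have hf (x y : ℝ) : f (x, y) = A * x + B * y := by
    calc f (x, y) = f (x • (1, 0) + y • (0, 1)) := by simp
      _ = A * x + B * y := by simp only [map_add, map_smul, smul_eq_mul, mul_comm, A, B]
  have hsep (r t : ℝ≥0) (hrt : φ r ≤ t) : u < A * r + B * t :=
    hf r t ▸ huf _ ⟨(r, t), hrt, rfl⟩
  rw [hf] at hfu
  have hB : 0 ≤ B := by
    by_contra! hB
    obtain ⟨n, hn⟩ := exists_nat_gt ((u - A) / B)
    have := hsep 1 n (by simp [hφ.map_one])
    rw [div_lt_iff_of_neg hB] at hn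
    push_cast at this
    linarith
  -- Since the epigraph lies over `t ≥ 0`, increasing `B` a little makes the line non-vertical.
  obtain ⟨ε, hε, hεc⟩ : ∃ ε > 0, A * r₀ + B * c + ε * c < u := by
    refine ⟨(u - (A * r₀ + B * c)) / (c + 1), div_pos (by linarith) (by positivity), ?_⟩
    rw [← lt_sub_iff_add_lt', div_mul_eq_mul_div, div_lt_iff₀ (by positivity)]
    nlinarith
  refine ⟨A, B + ε, u, by positivity, by linarith, fun r t hrt => ?_⟩
  have : 0 ≤ ε * t := by positivity
  linarith [hsep r t hrt]

theorem IsEntropy.exists_affineMinorant_ge (hφ : IsEntropy φ) {r : ℝ≥0} {c : ℝ≥0}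
    (hc : c < φ r) : ∃ p ∈ affineMinorants φ, (c : ℝ) ≤ p.1 * r - p.2 := by
  obtain ⟨A, B, u, hB, hcu, hu⟩ := hφ.exists_separation hc
  have heq (s : ℝ) : -(A / B) * s - -(u / B) = (u - A * s) / B := by ring
  refine ⟨(-(A / B), -(u / B)), mem_affineMinorants_iff.2 fun s t hst => ?_, ?_⟩
  · rw [heq, div_le_iff₀ hB]
    linarith [hu s t hst]
  · rw [heq, le_div_iff₀ hB]
    linarith

/-- The perspective function `(a, b) ↦ b * φ (a / b)` of `φ`, extended by `a * φ'_∞` at `b = 0`. It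
is encoded as the supremum of the homogeneous linear forms given by the affine minorants of `φ`. -/
def perspective (φ : ℝ≥0 → ℝ≥0∞) (a b : ℝ≥0) : ℝ≥0∞ :=
  ⨆ p ∈ affineMinorants φ, ENNReal.ofReal (p.1 * a - p.2 * b)

theorem IsEntropy.perspective_one_right (hφ : IsEntropy φ) (r : ℝ≥0) :
    perspective φ r 1 = φ r := by
  refine le_antisymm (iSup₂_le fun p hp => by simpa using hp r) ?_
  refine ENNReal.le_of_forall_nnreal_lt fun c hc => ?_
  obtain ⟨p, hp, hcp⟩ := hφ.exists_affineMinorant_ge hc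
  refine le_iSup₂_of_le p hp ?_
  simpa using ENNReal.ofReal_le_ofReal hcp

theorem IsEntropy.slope_le_recession (hφ : IsEntropy φ) {p : ℝ × ℝ}
    (hp : p ∈ affineMinorants φ) : ENNReal.ofReal p.1 ≤ recession φ := by
  have hinv : Tendsto (fun r : ℝ≥0 => (r : ℝ)⁻¹) atTop (𝓝 0) :=
    tendsto_inv_atTop_zero.comp (NNReal.tendsto_coe_atTop.2 tendsto_id)
  have hslope : Tendsto (fun r : ℝ≥0 => ENNReal.ofReal (p.1 - p.2 * (r : ℝ)⁻¹)) atTop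
      (𝓝 (ENNReal.ofReal p.1)) := by
    simpa using ENNReal.tendsto_ofReal ((hinv.const_mul p.2).const_sub p.1)
  refine le_of_tendsto_of_tendsto hslope hφ.tendsto_recession ?_
  filter_upwards [eventually_gt_atTop 0] with r hr
  have hr' : (0 : ℝ) < r := by exact_mod_cast hr
  rw [ENNReal.le_div_iff_mul_le (by simp [hr.ne']) (by simp), ← ENNReal.ofReal_coe_nnreal,
    ← ENNReal.ofReal_mul' hr'.le, sub_mul, inv_mul_cancel_right₀ hr'.ne']
  exact hp r

theorem IsEntropy.exists_affineMinorant_slope_eq (hφ : IsEntropy φ) {K : ℝ≥0}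
    (hK : K < recession φ) : ∃ b : ℝ, ((K : ℝ), b) ∈ affineMinorants φ := by
  obtain ⟨R, hR⟩ := eventually_atTop.1 (hφ.tendsto_recession.eventually_const_lt hK)
  refine ⟨K * R, mem_affineMinorants_iff.2 fun r t hrt => ?_⟩
  rw [← mul_sub]
  rcases le_or_gt R r with hr | hr
  · have hKr : K * r ≤ t := by
      have : K * (r : ℝ≥0∞) ≤ φ r := ENNReal.mul_le_of_le_div (hR r hr).le
      exact_mod_cast this.trans hrt
    calc (K : ℝ) * (r - R) ≤ K * r := by gcongr; simp
      _ ≤ t := by exact_mod_cast hKr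
  · have : (r : ℝ) - R ≤ 0 := sub_nonpos.2 (by exact_mod_cast hr.le)
    exact (mul_nonpos_of_nonneg_of_nonpos K.2 this).trans t.2

theorem IsEntropy.perspective_one_zero (hφ : IsEntropy φ) : perspective φ 1 0 = recession φ := by
  refine le_antisymm (iSup₂_le fun p hp => by simpa using hφ.slope_le_recession hp) ?_
  refine ENNReal.le_of_forall_nnreal_lt fun K hK => ?_
  obtain ⟨b, hb⟩ := hφ.exists_affineMinorant_slope_eq hK
  exact le_iSup₂_of_le _ hb (by simp)

theorem exists_seq_perspective_eq (φ : ℝ≥0 → ℝ≥0∞) :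
    ∃ p : ℕ → ℝ × ℝ, (∀ n, p n ∈ affineMinorants φ) ∧
      ∀ a b : ℝ≥0, perspective φ a b = ⨆ n, ENNReal.ofReal ((p n).1 * a - (p n).2 * b) := by
  have : Nonempty (affineMinorants φ) := ⟨⟨0, zero_mem_affineMinorants φ⟩⟩
  refine ⟨fun n => denseSeq (affineMinorants φ) n, fun n => Subtype.prop _, fun a b => ?_⟩
  have hcont : Continuous fun p : affineMinorants φ =>
      ENNReal.ofReal (p.1.1 * a - p.1.2 * b) := ENNReal.continuous_ofReal.comp (by fun_prop)
  rw [perspective, iSup_subtype', ← (denseRange_denseSeq (affineMinorants φ)).ciSup' hcont,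
    iSup_range' fun p : affineMinorants φ => ENNReal.ofReal (p.1.1 * a - p.1.2 * b)]

end AffineMinorants

section Pairing

variable {Ω : Type*} [MeasurableSpace Ω] {φ : ℝ≥0 → ℝ≥0∞}

theorem IsEntropy.exists_csiszar_eq_lintegral_perspective (hφ : IsEntropy φ) (α β : Measure Ω)
    [SigmaFinite α] [α.HaveLebesgueDecomposition β] :
    ∃ (σ : Measure Ω) (u v : Ω → ℝ≥0), Measurable u ∧ Measurable v ∧
      α = σ.withDensity (fun x => u x) ∧ β = σ.withDensity (fun x => v x) ∧
      csiszar φ α β = ∫⁻ x, perspective φ (u x) (v x) ∂σ := by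
  obtain ⟨s, hs, hs_sing, hs_β⟩ := Measure.mutuallySingular_singularPart α β
  set r := fun x => (α.rnDeriv β x).toNNReal
  have hr : Measurable r := (Measure.measurable_rnDeriv α β).ennreal_toNNReal
  classical
  let u : Ω → ℝ≥0 := s.piecewise r 1
  let v : Ω → ℝ≥0 := s.piecewise 1 0
  have hβ : ∀ᵐ x ∂β, u x = r x ∧ v x = 1 := by
    filter_upwards [compl_mem_ae_iff.2 hs_β] with x hx
    rw [compl_compl] at hx
    simp [u, v, hx]
  have hsing : ∀ᵐ x ∂α.singularPart β, u x = 1 ∧ v x = 0 := by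
    filter_upwards [compl_mem_ae_iff.2 hs_sing] with x hx
    simp [u, v, show x ∉ s from hx]
  refine ⟨β + α.singularPart β, u, v, hr.piecewise hs measurable_one,
    measurable_one.piecewise hs measurable_zero, ?_, ?_, ?_⟩
  · rw [withDensity_add_measure, withDensity_congr_ae (g := α.rnDeriv β),
      withDensity_congr_ae (μ := α.singularPart β) (g := 1), withDensity_one,
      Measure.rnDeriv_add_singularPart]
    · filter_upwards [hsing] with x hx using by simp [hx]
    · filter_upwards [hβ, Measure.rnDeriv_lt_top α β] with x hx hlt using by
        simp [hx, r, ENNReal.coe_toNNReal hlt.ne]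
  · rw [withDensity_add_measure, withDensity_congr_ae (g := 1),
      withDensity_congr_ae (μ := α.singularPart β) (g := 0), withDensity_one, withDensity_zero,
      add_zero]
    · filter_upwards [hsing] with x hx using by simp [hx]
    · filter_upwards [hβ] with x hx using by simp [hx]
  · rw [lintegral_add_measure, csiszar, ← lintegral_const]
    congr 1
    · refine lintegral_congr_ae ?_
      filter_upwards [hβ] with x hx using by rw [hx.1, hx.2, hφ.perspective_one_right]
    · refine lintegral_congr_ae ?_
      filter_upwards [hsing] with x hx using by rw [hx.1, hx.2, hφ.perspective_one_zero]

theorem integral_withDensity_sub_integral_withDensity {σ : Measure Ω} {u v : Ω → ℝ≥0}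
    (hu : Measurable u) (hv : Measurable v) {f : Ω → ℝ × ℝ}
    (hf₁ : Integrable (fun x => (f x).1) (σ.withDensity fun x => u x))
    (hf₂ : Integrable (fun x => (f x).2) (σ.withDensity fun x => v x)) :
    Integrable (fun x => (f x).1 * u x - (f x).2 * v x) σ ∧
      ∫ x, (f x).1 ∂σ.withDensity (fun x => u x) - ∫ x, (f x).2 ∂σ.withDensity (fun x => v x) =
        ∫ x, ((f x).1 * u x - (f x).2 * v x) ∂σ := by
  simp only [integral_withDensity_eq_integral_smul hu, integral_withDensity_eq_integral_smul hv]
  rw [integrable_withDensity_iff_integrable_smul hu] at hf₁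
  rw [integrable_withDensity_iff_integrable_smul hv] at hf₂
  simp only [NNReal.smul_def, smul_eq_mul, mul_comm] at hf₁ hf₂ ⊢
  exact ⟨hf₁.sub hf₂, (integral_sub hf₁ hf₂).symm⟩

theorem ofReal_integral_le_lintegral_ofReal (μ : Measure Ω) (g : Ω → ℝ) :
    ENNReal.ofReal (∫ x, g x ∂μ) ≤ ∫⁻ x, ENNReal.ofReal (g x) ∂μ := by
  by_cases hg : Integrable g μ
  · rw [integral_eq_lintegral_pos_part_sub_lintegral_neg_part hg]
    exact (ENNReal.ofReal_le_ofReal (sub_le_self _ ENNReal.toReal_nonneg)).trans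
      ENNReal.ofReal_toReal_le
  · simp [integral_undef hg]

theorem IsEntropy.ofReal_integral_sub_integral_le_csiszar (hφ : IsEntropy φ) {α β : Measure Ω}
    [SigmaFinite α] [α.HaveLebesgueDecomposition β] {f : Ω → ℝ × ℝ}
    (hf₁ : Integrable (fun x => (f x).1) α) (hf₂ : Integrable (fun x => (f x).2) β)
    (hf : ∀ x, f x ∈ affineMinorants φ) :
    ENNReal.ofReal (∫ x, (f x).1 ∂α - ∫ x, (f x).2 ∂β) ≤ csiszar φ α β := by
  obtain ⟨σ, u, v, hu, hv, hα, hβ, hφσ⟩ := hφ.exists_csiszar_eq_lintegral_perspective α β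
  rw [hφσ]
  rw [hα] at hf₁ ⊢
  rw [hβ] at hf₂ ⊢
  rw [(integral_withDensity_sub_integral_withDensity hu hv hf₁ hf₂).2]
  refine (ofReal_integral_le_lintegral_ofReal _ _).trans (lintegral_mono fun x => ?_)
  exact le_iSup₂_of_le (f x) (hf x) le_rfl

theorem lintegral_iSup_eq_iSup_finset {ι : Type*} [Countable ι] {μ : Measure Ω}
    {f : ι → Ω → ℝ≥0∞} (hf : ∀ i, Measurable (f i)) :
    ∫⁻ x, ⨆ i, f i x ∂μ = ⨆ s : Finset ι, ∫⁻ x, ⨆ i ∈ s, f i x ∂μ := by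
  simp only [iSup_eq_iSup_finset fun i => f i _]
  refine lintegral_iSup_directed
    (fun s => (Measurable.biSup _ s.countable_toSet fun i _ => hf i).aemeasurable)
    (Monotone.directed_le fun s t hst x => ?_)
  exact biSup_mono fun i hi => hst hi

theorem exists_simpleFunc_argmax {ι : Type*} {F : Finset ι} (hF : F.Nonempty) {g : ι → Ω → ℝ}
    (hg : ∀ i, Measurable (g i)) :
    ∃ k : SimpleFunc Ω ι, ∀ x, k x ∈ F ∧ ∀ i ∈ F, g i x ≤ g (k x) x := by
  classical
  induction hF using Finset.Nonempty.cons_induction with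
  | singleton i => exact ⟨.const Ω i, by simp⟩
  | cons i F hi _ ih =>
    obtain ⟨k, hk⟩ := ih
    have hmeas : MeasurableSet {x | g (k x) x ≤ g i x} :=
      measurableSet_le (k.measurable_bind _ hg) (hg i)
    refine ⟨.piecewise _ hmeas (.const Ω i) k, fun x => ?_⟩
    by_cases hx : g (k x) x ≤ g i x
    · simpa [SimpleFunc.piecewise_apply, hx] using fun j hj => ((hk x).2 j hj).trans hx
    · simpa [SimpleFunc.piecewise_apply, hx, (hk x).1, (not_le.1 hx).le] using (hk x).2

theorem integrable_comp_simpleFunc {E : Type*} {μ : Measure Ω} [IsFiniteMeasure μ]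
    (k : SimpleFunc Ω E) (g : E → ℝ) : Integrable (fun x => g (k x)) μ :=
  (k.map g).integrable_of_isFiniteMeasure

theorem IsEntropy.exists_simpleFunc_lt_of_lt_csiszar (hφ : IsEntropy φ) {α β : Measure Ω}
    [IsFiniteMeasure α] [IsFiniteMeasure β] {c : ℝ≥0∞} (hc : c < csiszar φ α β) :
    ∃ k : SimpleFunc Ω (ℝ × ℝ), (∀ x, k x ∈ affineMinorants φ) ∧
      c < ENNReal.ofReal (∫ x, (k x).1 ∂α - ∫ x, (k x).2 ∂β) := by
  obtain ⟨σ, u, v, hu, hv, hα, hβ, hφσ⟩ := hφ.exists_csiszar_eq_lintegral_perspective α β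
  obtain ⟨p, hp, hφp⟩ := exists_seq_perspective_eq φ
  let g (q : ℝ × ℝ) (x : Ω) : ℝ := q.1 * u x - q.2 * v x
  have hg (q : ℝ × ℝ) : Measurable (g q) := by fun_prop
  simp only [hφσ, hφp] at hc
  rw [lintegral_iSup_eq_iSup_finset fun n => (hg (p n)).ennreal_ofReal, lt_iSup_iff] at hc
  obtain ⟨t, ht⟩ := hc
  classical
  obtain ⟨k, hk⟩ := exists_simpleFunc_argmax (Finset.insert_nonempty 0 (t.image p)) hg
  refine ⟨k, fun x => ?_, ht.trans_le ?_⟩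
  · rcases Finset.mem_insert.1 (hk x).1 with h0 | hkt
    · exact h0 ▸ zero_mem_affineMinorants φ
    · obtain ⟨n, -, hn⟩ := Finset.mem_image.1 hkt
      exact hn ▸ hp n
  have hk_nonneg (x : Ω) : 0 ≤ g (k x) x := by
    simpa [g] using (hk x).2 0 (Finset.mem_insert_self _ _)
  have hk_max (x : Ω) : ⨆ n ∈ t, ENNReal.ofReal (g (p n) x) ≤ ENNReal.ofReal (g (k x) x) :=
    iSup₂_le fun n hn => ENNReal.ofReal_le_ofReal <|
      (hk x).2 _ (Finset.mem_insert_of_mem (Finset.mem_image_of_mem p hn))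
  have hk₁ : Integrable (fun x => (k x).1) α := integrable_comp_simpleFunc k _
  have hk₂ : Integrable (fun x => (k x).2) β := integrable_comp_simpleFunc k _
  rw [hα] at hk₁ ⊢
  rw [hβ] at hk₂ ⊢
  obtain ⟨hint, heq⟩ := integral_withDensity_sub_integral_withDensity hu hv hk₁ hk₂
  rw [heq, ofReal_integral_eq_lintegral_ofReal hint (.of_forall hk_nonneg)]
  exact lintegral_mono hk_max

end Pairing

section Duality

variable {Ω : Type*} [TopologicalSpace Ω] {E : Type*} [AddCommGroup E] [Module ℝ E]
  [TopologicalSpace E] [ContinuousAdd E] [ContinuousSMul ℝ E]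

theorem exists_continuous_mem_convexHull_eqOn_iUnion [NormalSpace Ω] [ParacompactSpace Ω]
    {ι : Type*} [Finite ι] {K : ι → Set Ω} (hK : ∀ i, IsClosed (K i)) {f : Ω → E} {y : ι → E}
    (hf : ∀ i, ∀ x ∈ K i, f x = y i) :
    ∃ g : C(Ω, E), (∀ x, g x ∈ convexHull ℝ (Set.range f)) ∧ Set.EqOn g f (⋃ i, K i) := by
  let t (x : Ω) : Set E := convexHull ℝ (Set.range f) ∩ ⋂ (i) (_ : x ∈ K i), {y i}
  have ht (x : Ω) : Convex ℝ (t x) :=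
    (convex_convexHull ℝ _).inter (convex_iInter₂ fun i _ => convex_singleton _)
  have hlocal (x : Ω) : ∃ c, ∀ᶠ x' in 𝓝 x, c ∈ t x' := by
    have hfar : ∀ᶠ x' in 𝓝 x, ∀ i, x' ∈ K i → x ∈ K i := eventually_all.2 fun i => by
      by_cases hx : x ∈ K i
      · exact .of_forall fun _ _ => hx
      · filter_upwards [(hK i).isOpen_compl.mem_nhds hx] with x' hx' h using absurd h hx'
    refine ⟨f x, hfar.mono fun x' hx' => ⟨subset_convexHull ℝ _ ⟨x, rfl⟩, ?_⟩⟩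
    exact Set.mem_iInter₂.2 fun i hi => hf i x (hx' i hi)
  obtain ⟨g, hg⟩ := exists_continuous_forall_mem_convex_of_local_const ht hlocal
  refine ⟨g, fun x => (hg x).1, fun x hx => ?_⟩
  obtain ⟨i, hi⟩ := Set.mem_iUnion.1 hx
  exact (Set.mem_iInter₂.1 (hg x).2 i hi).trans (hf i x hi).symm

variable [MeasurableSpace Ω] [OpensMeasurableSpace Ω]

theorem exists_continuous_mem_convexHull_measure_ne_le [NormalSpace Ω] [ParacompactSpace Ω]
    (γ : Measure Ω) [IsFiniteMeasure γ] [γ.WeaklyRegular] (f : SimpleFunc Ω E) {ε : ℝ≥0∞}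
    (hε : ε ≠ 0) :
    ∃ g : C(Ω, E), (∀ x, g x ∈ convexHull ℝ (Set.range f)) ∧ γ {x | g x ≠ f x} ≤ ε := by
  obtain ⟨δ, hδ, hδε⟩ := ENNReal.exists_pos_sum_of_countable' hε f.range
  choose K hKf hK_closed hKδ using fun y : f.range =>
    (f.measurableSet_fiber (y : E)).exists_isClosed_sdiff_lt (measure_ne_top γ _) (hδ y).ne'
  obtain ⟨g, hg_mem, hg⟩ := exists_continuous_mem_convexHull_eqOn_iUnion hK_closed hKf
  refine ⟨g, hg_mem, ?_⟩
  have hne : {x | g x ≠ f x} ⊆ ⋃ y : f.range, (f ⁻¹' {(y : E)}) \ K y := fun x hx =>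
    Set.mem_iUnion.2 ⟨⟨f x, f.mem_range_self x⟩, rfl,
      fun hxK => hx (hg (Set.mem_iUnion_of_mem _ hxK))⟩
  calc γ {x | g x ≠ f x} ≤ ∑' y : f.range, γ ((f ⁻¹' {(y : E)}) \ K y) :=
        (measure_mono hne).trans (measure_iUnion_le _)
    _ ≤ ∑' y, δ y := ENNReal.tsum_le_tsum fun y => (hKδ y).le
    _ ≤ ε := hδε.le

theorem exists_seq_continuous_mem_convexHull_eventually_eq [NormalSpace Ω] [ParacompactSpace Ω]
    (γ : Measure Ω) [IsFiniteMeasure γ] [γ.WeaklyRegular] (f : SimpleFunc Ω E) :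
    ∃ g : ℕ → C(Ω, E), (∀ n x, g n x ∈ convexHull ℝ (Set.range f)) ∧
      ∀ᵐ x ∂γ, ∀ᶠ n in atTop, g n x = f x := by
  obtain ⟨ε, hε, hε_sum⟩ := ENNReal.exists_pos_sum_of_countable' one_ne_zero ℕ
  choose g hg_mem hg using fun n =>
    exists_continuous_mem_convexHull_measure_ne_le γ f (hε n).ne'
  refine ⟨g, hg_mem, ?_⟩
  have hsum : ∑' n, γ {x | g n x ≠ f x} ≠ ⊤ :=
    ((ENNReal.tsum_le_tsum hg).trans_lt (hε_sum.trans ENNReal.one_lt_top)).ne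
  filter_upwards [ae_eventually_notMem hsum] with x hx
  simpa using hx

theorem tendsto_integral_of_ae_eventually_eq {Ω : Type*} [MeasurableSpace Ω] {γ : Measure Ω}
    [IsFiniteMeasure γ] {g : ℕ → Ω → ℝ} {f : Ω → ℝ} (hg : ∀ n, AEStronglyMeasurable (g n) γ)
    {C : ℝ} (hC : ∀ n x, ‖g n x‖ ≤ C) (h : ∀ᵐ x ∂γ, ∀ᶠ n in atTop, g n x = f x) :
    Tendsto (fun n => ∫ x, g n x ∂γ) atTop (𝓝 (∫ x, f x ∂γ)) :=
  tendsto_integral_of_dominated_convergence (fun _ => C) hg (integrable_const C)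
    (fun n => .of_forall (hC n)) (h.mono fun _ hx => tendsto_nhds_of_eventually_eq hx)

theorem IsEntropy.exists_boundedContinuousFunction_lt_of_lt_csiszar [NormalSpace Ω]
    [ParacompactSpace Ω] {φ : ℝ≥0 → ℝ≥0∞} (hφ : IsEntropy φ) {α β : Measure Ω}
    [IsFiniteMeasure α] [IsFiniteMeasure β] [(α + β).WeaklyRegular] {c : ℝ≥0∞}
    (hc : c < csiszar φ α β) :
    ∃ g : Ω →ᵇ ℝ × ℝ, (∀ x, g x ∈ affineMinorants φ) ∧
      c < ENNReal.ofReal (∫ x, (g x).1 ∂α - ∫ x, (g x).2 ∂β) := by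
  obtain ⟨k, hkφ, hck⟩ := hφ.exists_simpleFunc_lt_of_lt_csiszar hc
  obtain ⟨g, hg_mem, hg⟩ := exists_seq_continuous_mem_convexHull_eventually_eq (α + β) k
  obtain ⟨hgα, hgβ⟩ := ae_add_measure_iff.1 hg
  have hbdd : Bornology.IsBounded (convexHull ℝ (Set.range k)) :=
    isBounded_convexHull.2 k.finite_range.isBounded
  obtain ⟨C, hC⟩ := hbdd.exists_norm_le
  have hgC (n : ℕ) (x : Ω) : ‖g n x‖ ≤ C := hC _ (hg_mem n x)
  have hlim₁ : Tendsto (fun n => ∫ x, (g n x).1 ∂α) atTop (𝓝 (∫ x, (k x).1 ∂α)) :=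
    tendsto_integral_of_ae_eventually_eq
      (fun n => (continuous_fst.comp (g n).continuous).aestronglyMeasurable)
      (fun n x => (norm_fst_le _).trans (hgC n x))
      (hgα.mono fun _ hx => hx.mono fun _ => congrArg Prod.fst)
  have hlim₂ : Tendsto (fun n => ∫ x, (g n x).2 ∂β) atTop (𝓝 (∫ x, (k x).2 ∂β)) :=
    tendsto_integral_of_ae_eventually_eq
      (fun n => (continuous_snd.comp (g n).continuous).aestronglyMeasurable)
      (fun n x => (norm_snd_le _).trans (hgC n x))
      (hgβ.mono fun _ hx => hx.mono fun _ => congrArg Prod.snd)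
  obtain ⟨n, hn⟩ := ((ENNReal.tendsto_ofReal (hlim₁.sub hlim₂)).eventually_const_lt hck).exists
  refine ⟨.ofNormedAddCommGroup (g n) (g n).continuous C (hgC n), fun x => ?_, hn⟩
  exact convexHull_min (Set.range_subset_iff.2 hkφ) (convex_affineMinorants φ) (hg_mem n x)

theorem IsEntropy.csiszar_eq_iSup [NormalSpace Ω] [ParacompactSpace Ω] {φ : ℝ≥0 → ℝ≥0∞}
    (hφ : IsEntropy φ) (α β : Measure Ω) [IsFiniteMeasure α] [IsFiniteMeasure β]
    [(α + β).WeaklyRegular] :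
    csiszar φ α β = ⨆ (g : Ω →ᵇ ℝ × ℝ) (_ : ∀ x, g x ∈ affineMinorants φ),
      ENNReal.ofReal (∫ x, (g x).1 ∂α - ∫ x, (g x).2 ∂β) := by
  refine le_antisymm (le_of_forall_lt fun c hc => ?_) (iSup₂_le fun g hg => ?_)
  · obtain ⟨g, hg, hcg⟩ := hφ.exists_boundedContinuousFunction_lt_of_lt_csiszar hc
    exact hcg.trans_le (le_iSup₂_of_le g hg le_rfl)
  · exact hφ.ofReal_integral_sub_integral_le_csiszar
      ((g.comp Prod.fst LipschitzWith.prod_fst).integrable α)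
      ((g.comp Prod.snd LipschitzWith.prod_snd).integrable β) hg

theorem IsEntropy.lowerSemicontinuous_csiszar {Ω : Type*} [TopologicalSpace Ω]
    [PseudoMetrizableSpace Ω] [MeasurableSpace Ω] [BorelSpace Ω] {φ : ℝ≥0 → ℝ≥0∞}
    (hφ : IsEntropy φ) (β : Measure Ω) [IsFiniteMeasure β] :
    LowerSemicontinuous fun α : FiniteMeasure Ω => csiszar φ α β := by
  let _ := pseudoMetrizableSpacePseudoMetric Ω
  simp only [hφ.csiszar_eq_iSup]
  refine lowerSemicontinuous_biSup fun g _ => Continuous.lowerSemicontinuous ?_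
  have hg : Continuous fun α : FiniteMeasure Ω => ∫ x, (g x).1 ∂(α : Measure Ω) :=
    FiniteMeasure.continuous_integral_boundedContinuousFunction
      (g.comp Prod.fst LipschitzWith.prod_fst)
  exact ENNReal.continuous_ofReal.comp (hg.sub continuous_const)

end Duality

section LowerSemicontinuity

theorem lowerSemicontinuous_add_ereal {α : Type*} [TopologicalSpace α] {f g : α → EReal}
    (hf : LowerSemicontinuous f) (hg : LowerSemicontinuous g) :
    LowerSemicontinuous fun x => f x + g x :=
  lowerSemicontinuous_iff_le_liminf.2 fun x =>
    (add_le_add (lowerSemicontinuous_iff_le_liminf.1 hf x)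
      (lowerSemicontinuous_iff_le_liminf.1 hg x)).trans EReal.le_liminf_add

theorem lowerSemicontinuous_coe_ennreal_ereal {α : Type*} [TopologicalSpace α] {f : α → ℝ≥0∞}
    (hf : LowerSemicontinuous f) : LowerSemicontinuous fun x => (f x : EReal) :=
  continuous_coe_ennreal_ereal.comp_lowerSemicontinuous hf EReal.coe_ennreal_strictMono.monotone

section lintegral

variable {Ω : Type*} [TopologicalSpace Ω]

theorem exists_boundedContinuousFunction_lt_apply [CompletelyRegularSpace Ω] {f : Ω → ℝ≥0∞}
    (hf : LowerSemicontinuous f) {x : Ω} {c : ℝ≥0∞} (hc : c < f x) :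
    ∃ g : Ω →ᵇ ℝ, (∀ y, ENNReal.ofReal (g y) ≤ f y) ∧ c < ENNReal.ofReal (g x) := by
  obtain ⟨c', hcc', hc'⟩ := ENNReal.lt_iff_exists_nnreal_btwn.1 hc
  obtain ⟨w, hw, hwx, hw_one⟩ := CompletelyRegularSpace.completely_regular x {y | f y ≤ c'}
    (hf.isClosed_preimage c') hc'.not_ge
  let g : Ω →ᵇ ℝ := .ofNormedAddCommGroup (fun y => c' * (1 - w y)) (by fun_prop) c' fun y => by
    rw [norm_mul, NNReal.norm_eq]
    exact mul_le_of_le_one_right c'.2 (by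
      simpa [abs_of_nonneg (unitInterval.one_minus_nonneg (w y))] using (w y).2.1)
  refine ⟨g, fun y => ?_, ?_⟩
  · rcases le_or_gt (f y) c' with hy | hy
    · simp [g, hw_one hy]
    · refine le_trans ?_ hy.le
      rw [← ENNReal.ofReal_coe_nnreal]
      exact ENNReal.ofReal_le_ofReal
        (mul_le_of_le_one_right c'.2 (sub_le_self _ (w y).2.1))
  · simpa [g, hwx] using hcc'

theorem exists_seq_boundedContinuousFunction_iSup_eq [CompletelyRegularSpace Ω]
    [HereditarilyLindelofSpace Ω] {f : Ω → ℝ≥0∞} (hf : LowerSemicontinuous f) :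
    ∃ g : ℕ → Ω →ᵇ ℝ, ∀ x, ⨆ n, ENNReal.ofReal (g n x) = f x := by
  let F : Set (Ω → ℝ≥0∞) := {h | h ≤ f ∧ ∃ g : Ω →ᵇ ℝ, h = fun x => ENNReal.ofReal (g x)}
  have hF (h) (hh : h ∈ F) : LowerSemicontinuous h := by
    obtain ⟨-, g, rfl⟩ := hh
    exact (ENNReal.continuous_ofReal.comp g.continuous).lowerSemicontinuous
  have hFf : IsLUB F f := by
    refine ⟨fun h hh => hh.1, fun b hb x => le_of_forall_lt fun c hc => ?_⟩
    obtain ⟨g, hgf, hg⟩ := exists_boundedContinuousFunction_lt_apply hf hc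
    exact hg.trans_le (hb ⟨hgf, g, rfl⟩ x)
  have h0 : (0 : Ω → ℝ≥0∞) ∈ F := ⟨fun _ => zero_le, 0, by ext; simp⟩
  obtain ⟨F', hF'F, hF', hF'f⟩ := exists_countable_lowerSemicontinuous_isLUB hF hFf
  obtain ⟨e, he⟩ := (hF'.insert 0).exists_eq_range (Set.insert_nonempty _ _)
  have heF (n : ℕ) : e n ∈ F :=
    Set.insert_subset h0 hF'F (he ▸ Set.mem_range_self n)
  choose _ g hg using heF
  have hlub : IsLUB (Set.range e) f := by
    rw [← he]
    simpa [show (0 : Ω → ℝ≥0∞) ⊔ f = f from sup_eq_right.2 h0.1] using hF'f.insert 0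
  refine ⟨g, fun x => ?_⟩
  rw [← hlub.iSup_eq, iSup_apply]
  exact iSup_congr fun n => (congrFun (hg n) x).symm

theorem exists_boundedContinuousFunction_biSup_eq {ι : Type*} (g : ι → Ω →ᵇ ℝ) (s : Finset ι) :
    ∃ h : Ω →ᵇ ℝ, ∀ x, ⨆ i ∈ s, ENNReal.ofReal (g i x) = ENNReal.ofReal (h x) := by
  classical
  induction s using Finset.induction_on with
  | empty => exact ⟨0, by simp⟩
  | insert i s _ ih =>
    obtain ⟨h, hh⟩ := ih
    refine ⟨g i ⊔ h, fun x => ?_⟩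
    rw [Finset.iSup_insert, hh, BoundedContinuousFunction.coe_sup, Pi.sup_apply, ENNReal.ofReal_max]

theorem lowerSemicontinuous_lintegral [CompletelyRegularSpace Ω] [HereditarilyLindelofSpace Ω]
    [MeasurableSpace Ω] [OpensMeasurableSpace Ω] {f : Ω → ℝ≥0∞} (hf : LowerSemicontinuous f) :
    LowerSemicontinuous fun γ : FiniteMeasure Ω => ∫⁻ x, f x ∂(γ : Measure Ω) := by
  obtain ⟨g, hg⟩ := exists_seq_boundedContinuousFunction_iSup_eq hf
  choose h hh using exists_boundedContinuousFunction_biSup_eq g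
  have hmeas (n : ℕ) : Measurable fun x => ENNReal.ofReal (g n x) :=
    (g n).continuous.measurable.ennreal_ofReal
  simp only [← hg, lintegral_iSup_eq_iSup_finset hmeas, hh]
  exact lowerSemicontinuous_iSup fun s => Continuous.lowerSemicontinuous <|
    FiniteMeasure.continuous_lintegral_boundedContinuousFunction (h s).nnrealPart

end lintegral

section integralEReal

theorem toENNReal_add_coe_add_toENNReal_neg {e : EReal} {N : ℝ≥0} (h : -((N : ℝ) : EReal) ≤ e) :
    (e + ((N : ℝ) : EReal)).toENNReal + (-e).toENNReal = e.toENNReal + N := by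
  induction e with
  | bot => simp at h
  | top => simp
  | coe x =>
    have hx : -N ≤ x := by exact_mod_cast h
    rw [← EReal.coe_add, ← EReal.coe_neg]
    simp only [EReal.real_coe_toENNReal]
    rw [← ENNReal.ofReal_coe_nnreal (p := N)]
    rcases le_total 0 x with hx0 | hx0
    · rw [ENNReal.ofReal_of_nonpos (neg_nonpos.2 hx0), add_zero]
      exact ENNReal.ofReal_add hx0 N.2
    · rw [ENNReal.ofReal_of_nonpos hx0, zero_add, ← ENNReal.ofReal_add (by linarith) (by linarith)]
      congr 1
      ring

theorem coe_sub_coe_eq_coe_sub_coe {a b : ℝ≥0∞} {s t : ℝ≥0} (h : a + s = b + t) :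
    (b : EReal) - ((s : ℝ) : EReal) = (a : EReal) - ((t : ℝ) : EReal) := by
  induction a with
  | top =>
    have hb : b = ⊤ := by simpa using h.symm
    simp [hb]
  | coe a =>
    lift b to ℝ≥0 using by
      rintro rfl
      simp at h
    have h' : (a : ℝ) + s = b + t := by exact_mod_cast h
    change ((b : ℝ) : EReal) - ((s : ℝ) : EReal) = ((a : ℝ) : EReal) - ((t : ℝ) : EReal)
    rw [← EReal.coe_sub, ← EReal.coe_sub]
    congr 1
    linarith

variable {Ω : Type*} [MeasurableSpace Ω]

theorem integralEReal_mono {f g : Ω → EReal} (hfg : f ≤ g) (γ : Measure Ω) :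
    integralEReal f γ ≤ integralEReal g γ :=
  EReal.sub_le_sub
    (EReal.coe_ennreal_le_coe_ennreal_iff.2
      (lintegral_mono fun x => EReal.toENNReal_le_toENNReal (hfg x)))
    (EReal.coe_ennreal_le_coe_ennreal_iff.2
      (lintegral_mono fun x => EReal.toENNReal_le_toENNReal (EReal.neg_le_neg_iff.2 (hfg x))))

theorem integralEReal_const (m : ℝ) (γ : Measure Ω) [IsFiniteMeasure γ] :
    integralEReal (fun _ => (m : EReal)) γ = ((m * γ.real Set.univ : ℝ) : EReal) := by
  simp only [integralEReal, lintegral_const, ← EReal.coe_neg, EReal.real_coe_toENNReal]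
  rw [← ofReal_measureReal, ← ENNReal.ofReal_mul' measureReal_nonneg,
    ← ENNReal.ofReal_mul' measureReal_nonneg, EReal.coe_ennreal_ofReal, EReal.coe_ennreal_ofReal,
    ← EReal.coe_sub, neg_mul, max_zero_sub_max_neg_zero_eq_self]

theorem integralEReal_eq_lintegral_sub {g : Ω → EReal} (hg : Measurable g) {N : ℝ≥0}
    (hN : ∀ x, -((N : ℝ) : EReal) ≤ g x) (γ : FiniteMeasure Ω) :
    integralEReal g γ =
      ((∫⁻ x, (g x + ((N : ℝ) : EReal)).toENNReal ∂(γ : Measure Ω) : ℝ≥0∞) : EReal)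
        - (((N * γ.mass : ℝ≥0) : ℝ) : EReal) := by
  have hneg_le (x : Ω) : (-g x).toENNReal ≤ N := by
    have := EReal.toENNReal_le_toENNReal (EReal.neg_le_of_neg_le (hN x))
    rwa [EReal.real_coe_toENNReal, ENNReal.ofReal_coe_nnreal] at this
  have hneg_ne_top : ∫⁻ x, (-g x).toENNReal ∂(γ : Measure Ω) ≠ ⊤ :=
    ((lintegral_mono hneg_le).trans_lt (by simp [ENNReal.mul_lt_top_iff])).ne
  have hint := lintegral_congr (μ := (γ : Measure Ω))
    fun x => toENNReal_add_coe_add_toENNReal_neg (hN x)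
  have hneg_meas : Measurable fun x => (-g x).toENNReal := hg.neg.ereal_toENNReal
  rw [lintegral_add_right _ hneg_meas, lintegral_add_right _ measurable_const,
    lintegral_const, ← FiniteMeasure.ennreal_mass, ← ENNReal.coe_mul] at hint
  rw [integralEReal]
  lift ∫⁻ x, (-g x).toENNReal ∂(γ : Measure Ω) to ℝ≥0 using hneg_ne_top with b
  exact coe_sub_coe_eq_coe_sub_coe hint

theorem continuous_toENNReal_add_coe (m : ℝ) :
    Continuous fun e : EReal => (e + (m : EReal)).toENNReal :=
  EReal.continuous_toENNReal.comp <| continuous_iff_continuousAt.2 fun _ =>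
    (EReal.continuousAt_add (.inr (EReal.coe_ne_bot m)) (.inr (EReal.coe_ne_top m))).comp₂
      continuousAt_id continuousAt_const

theorem monotone_toENNReal_add_coe (m : ℝ) :
    Monotone fun e : EReal => (e + (m : EReal)).toENNReal :=
  fun _ _ h => EReal.toENNReal_le_toENNReal (by gcongr)

theorem lowerSemicontinuous_integralEReal {Ω : Type*} [TopologicalSpace Ω]
    [CompletelyRegularSpace Ω] [HereditarilyLindelofSpace Ω] [MeasurableSpace Ω]
    [OpensMeasurableSpace Ω] {g : Ω → EReal} (hg : LowerSemicontinuous g) {m : ℝ}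
    (hm : ∀ x, (m : EReal) ≤ g x) :
    LowerSemicontinuous fun γ : FiniteMeasure Ω => integralEReal g γ := by
  let N : ℝ≥0 := (-m).toNNReal
  have hN (x : Ω) : -((N : ℝ) : EReal) ≤ g x := by
    refine le_trans ?_ (hm x)
    rw [← EReal.coe_neg, EReal.coe_le_coe_iff]
    exact neg_le_of_neg_le (Real.le_coe_toNNReal (-m))
  simp only [integralEReal_eq_lintegral_sub hg.measurable hN, sub_eq_add_neg, ← EReal.coe_neg]
  have hlintegral := lowerSemicontinuous_coe_ennreal_ereal <| lowerSemicontinuous_lintegral <|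
    (continuous_toENNReal_add_coe N).comp_lowerSemicontinuous hg (monotone_toENNReal_add_coe N)
  have hmass : Continuous fun γ : FiniteMeasure Ω => ((-((N * γ.mass : ℝ≥0) : ℝ) : ℝ) : EReal) :=
    continuous_coe_real_ereal.comp (by fun_prop)
  exact lowerSemicontinuous_add_ereal hlintegral hmass.lowerSemicontinuous

end integralEReal

end LowerSemicontinuity

section Product

variable {α β : Type*} [MeasurableSpace α] [MeasurableSpace β]

theorem mass_mul_mass_smul_prod_normalize [Nonempty α] [Nonempty β] (ρ : FiniteMeasure α)
    (σ : FiniteMeasure β) :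
    (ρ.mass * σ.mass) • (ρ.normalize.prod σ.normalize).toFiniteMeasure = ρ.prod σ := by
  conv_rhs => rw [ρ.self_eq_mass_smul_normalize, σ.self_eq_mass_smul_normalize]
  refine Subtype.ext ?_
  change (ρ.mass * σ.mass) • ((ρ.normalize : Measure α).prod (σ.normalize : Measure β))
    = (ρ.mass • (ρ.normalize : Measure α)).prod (σ.mass • (σ.normalize : Measure β))
  simp only [ENNReal.smul_def, Measure.prod_smul_left, Measure.prod_smul_right, smul_smul,
    ENNReal.coe_mul, mul_comm]

theorem nonempty_of_finiteMeasure_ne_zero {ρ : FiniteMeasure α} (hρ : ρ ≠ 0) : Nonempty α := by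
  by_contra h
  rw [not_nonempty_iff] at h
  exact hρ (Subtype.ext (Measure.eq_zero_of_isEmpty _))

theorem continuous_finiteMeasure_prod
    [TopologicalSpace α] [PseudoMetrizableSpace α] [SecondCountableTopology α]
    [OpensMeasurableSpace α] [TopologicalSpace β] [PseudoMetrizableSpace β]
    [SecondCountableTopology β] [OpensMeasurableSpace β] :
    Continuous fun p : FiniteMeasure α × FiniteMeasure β => p.1.prod p.2 := by
  have hmass : Continuous fun p : FiniteMeasure α × FiniteMeasure β => p.1.mass * p.2.mass := by
    fun_prop
  refine continuous_iff_continuousAt.2 fun ⟨ρ, σ⟩ => ?_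
  rcases eq_or_ne (ρ.prod σ) 0 with hzero | hne
  · rw [ContinuousAt, hzero]
    refine FiniteMeasure.tendsto_zero_of_tendsto_zero_mass ?_
    simpa [← FiniteMeasure.mass_prod, hzero] using hmass.tendsto (ρ, σ)
  · have hρ : ρ ≠ 0 := by
      rintro rfl
      simp at hne
    have hσ : σ ≠ 0 := by
      rintro rfl
      simp at hne
    have := nonempty_of_finiteMeasure_ne_zero hρ
    have := nonempty_of_finiteMeasure_ne_zero hσ
    have hnormalize : ContinuousAt (fun p : FiniteMeasure α × FiniteMeasure β =>
        (p.1.normalize, p.2.normalize)) (ρ, σ) :=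
      (FiniteMeasure.tendsto_normalize_of_tendsto continuous_fst.continuousAt hρ).prodMk_nhds
        (FiniteMeasure.tendsto_normalize_of_tendsto continuous_snd.continuousAt hσ)
    have hprod : Continuous fun p : ProbabilityMeasure α × ProbabilityMeasure β =>
        (p.1.prod p.2).toFiniteMeasure :=
      ProbabilityMeasure.toFiniteMeasure_continuous.comp ProbabilityMeasure.continuous_prod
    refine (hmass.continuousAt.smul (hprod.continuousAt.comp hnormalize)).congr (.of_forall ?_)
    exact fun p => mass_mul_mass_smul_prod_normalize p.1 p.2

end Product

section DirectMethod

theorem exists_forall_le_of_lowerSemicontinuous {α β : Type*} [TopologicalSpace α] [Nonempty α]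
    [LinearOrder β] [OrderTop β] [TopologicalSpace β] [OrderTopology β] {F : α → β}
    (hF : LowerSemicontinuous F) (hF_top : Tendsto F (cocompact α) (𝓝 ⊤)) :
    ∃ x, ∀ y, F x ≤ F y := by
  by_cases htop : ∀ x, F x = ⊤
  · exact ⟨Classical.arbitrary α, fun y => le_top.trans_eq (htop y).symm⟩
  · push Not at htop
    obtain ⟨x₀, hx₀⟩ := htop
    obtain ⟨K, hK, hFK⟩ := mem_cocompact.1 (hF_top.eventually_const_lt hx₀.lt_top)
    obtain ⟨x, -, hx⟩ := LowerSemicontinuousOn.exists_isMinOn (Set.insert_nonempty x₀ K)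
      (hK.insert x₀) (hF.lowerSemicontinuousOn _)
    refine ⟨x, fun y => ?_⟩
    by_cases hy : y ∈ K
    · exact hx (Set.mem_insert_of_mem x₀ hy)
    · exact (hx (Set.mem_insert x₀ K)).trans (hFK hy).le

theorem tendsto_mass_cocompact_atTop (Ω : Type*) [TopologicalSpace Ω] [CompactSpace Ω] [T2Space Ω]
    [MeasurableSpace Ω] [BorelSpace Ω] :
    Tendsto (fun π : FiniteMeasure Ω => π.mass) (cocompact (FiniteMeasure Ω)) atTop :=
  tendsto_atTop.2 fun R => mem_cocompact.2
    ⟨_, isCompact_setOfPred_finiteMeasure_le_of_compactSpace Ω R,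
      fun _ hπ => (not_le.1 (Set.notMem_ofPred_iff.1 hπ)).le⟩

end DirectMethod

section Functional

theorem IsEntropy.coe_le_quadCsiszar {Ω : Type*} [MeasurableSpace Ω] {φ : ℝ≥0 → ℝ≥0∞}
    (hφ : IsEntropy φ) {p : ℝ × ℝ} (hp : p ∈ affineMinorants φ) (ρ μ : Measure Ω)
    [IsFiniteMeasure ρ] [IsFiniteMeasure μ] :
    ((p.1 * ρ.real Set.univ ^ 2 - p.2 * μ.real Set.univ ^ 2 : ℝ) : EReal)
      ≤ (quadCsiszar φ ρ μ : EReal) := by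
  have hmass (τ : Measure Ω) [IsFiniteMeasure τ] :
      (τ.prod τ).real Set.univ = τ.real Set.univ ^ 2 := by
    rw [← Set.univ_prod_univ, measureReal_prod_prod, sq]
  have hle := hφ.ofReal_integral_sub_integral_le_csiszar (integrable_const p.1)
    (integrable_const p.2) (α := ρ.prod ρ) (β := μ.prod μ) (f := fun _ => p) fun _ => hp
  simp only [integral_const, hmass, smul_eq_mul] at hle
  refine le_trans ?_ (EReal.coe_ennreal_le_coe_ennreal_iff.2 hle)
  rw [EReal.coe_ennreal_ofReal, mul_comm p.1, mul_comm p.2, EReal.coe_le_coe_iff]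
  exact le_max_left _ _

theorem IsEntropy.lowerSemicontinuous_quadCsiszar {Ω : Type*} [TopologicalSpace Ω]
    [PseudoMetrizableSpace Ω] [SecondCountableTopology Ω] [MeasurableSpace Ω] [BorelSpace Ω]
    {φ : ℝ≥0 → ℝ≥0∞} (hφ : IsEntropy φ) (μ : Measure Ω) [IsFiniteMeasure μ] :
    LowerSemicontinuous fun ρ : FiniteMeasure Ω => quadCsiszar φ ρ μ :=
  (hφ.lowerSemicontinuous_csiszar (μ.prod μ)).comp
    (continuous_finiteMeasure_prod.comp (continuous_id.prodMk continuous_id))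

/-- The functional `functional`, with an arbitrary kernel `c` on `(X × Y) × (X × Y)` in place of
the distortion cost. -/
def kernelFunctional {X Y : Type*} [MeasurableSpace X] [MeasurableSpace Y] (φ : ℝ≥0 → ℝ≥0∞)
    (c : (X × Y) × (X × Y) → EReal) (μ : Measure X) (ν : Measure Y) (π : Measure (X × Y)) :
    EReal :=
  integralEReal c (π.prod π) + (quadCsiszar φ π.fst μ : EReal) + (quadCsiszar φ π.snd ν : EReal)

theorem IsEntropy.coe_le_kernelFunctional {X Y : Type*} [MeasurableSpace X] [MeasurableSpace Y]
    {φ : ℝ≥0 → ℝ≥0∞} (hφ : IsEntropy φ) {c : (X × Y) × (X × Y) → EReal} {m : ℝ}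
    (hm : ∀ z, (m : EReal) ≤ c z) {p : ℝ × ℝ} (hp : p ∈ affineMinorants φ) (μ : Measure X)
    [IsFiniteMeasure μ] (ν : Measure Y) [IsFiniteMeasure ν] (π : Measure (X × Y))
    [IsFiniteMeasure π] :
    (((2 * p.1 + m) * π.real Set.univ ^ 2
        - p.2 * (μ.real Set.univ ^ 2 + ν.real Set.univ ^ 2) : ℝ) : EReal)
      ≤ kernelFunctional φ c μ ν π := by
  have hc : ((m * π.real Set.univ ^ 2 : ℝ) : EReal) ≤ integralEReal c (π.prod π) := by
    rw [sq, ← measureReal_prod_prod, Set.univ_prod_univ, ← integralEReal_const]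
    exact integralEReal_mono hm _
  have hfst := hφ.coe_le_quadCsiszar hp π.fst μ
  have hsnd := hφ.coe_le_quadCsiszar hp π.snd ν
  rw [measureReal_def, Measure.fst_univ, ← measureReal_def] at hfst
  rw [measureReal_def, Measure.snd_univ, ← measureReal_def] at hsnd
  refine le_trans (le_of_eq ?_) (add_le_add (add_le_add hc hfst) hsnd)
  rw [← EReal.coe_add, ← EReal.coe_add]
  congr 1
  ring

theorem IsEntropy.exists_affineMinorant_growth {φ : ℝ≥0 → ℝ≥0∞} (hφ : IsEntropy φ) {l : EReal}
    (hl : 0 < 2 * (recession φ : EReal) + l) :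
    ∃ (m : ℝ) (p : ℝ × ℝ), (m : EReal) ≤ l ∧ p ∈ affineMinorants φ ∧ 0 < 2 * p.1 + m := by
  induction l with
  | bot => simp at hl
  | top => exact ⟨1, 0, le_top, zero_mem_affineMinorants φ, by simp⟩
  | coe m =>
    rcases lt_or_ge 0 m with hm | hm
    · exact ⟨m, 0, le_rfl, zero_mem_affineMinorants φ, by simpa using hm⟩
    · have hlt : ENNReal.ofReal (-m / 2) < recession φ := by
        by_contra! hle
        have hle' : (recession φ : EReal) ≤ ((-m / 2 : ℝ) : EReal) := by
          rw [← max_eq_left (show 0 ≤ -m / 2 by linarith), ← EReal.coe_ennreal_ofReal]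
          exact EReal.coe_ennreal_le_coe_ennreal_iff.2 hle
        refine hl.not_ge ?_
        calc 2 * (recession φ : EReal) + m ≤ ((2 : ℝ) : EReal) * ((-m / 2 : ℝ) : EReal) + m := by
              gcongr
              exact le_rfl
          _ = 0 := by
              rw [← EReal.coe_mul, ← EReal.coe_add, EReal.coe_eq_zero]
              ring
      obtain ⟨K, hmK, hK⟩ := ENNReal.lt_iff_exists_nnreal_btwn.1 hlt
      obtain ⟨b, hb⟩ := hφ.exists_affineMinorant_slope_eq hK
      rw [← ENNReal.ofReal_coe_nnreal, ENNReal.ofReal_lt_ofReal_iff_of_nonneg (by linarith)] at hmK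
      exact ⟨m, (K, b), le_rfl, hb, by linarith⟩

theorem tendsto_coe_mul_sq_sub_nhds_top {a : ℝ} (ha : 0 < a) (b : ℝ) :
    Tendsto (fun r : ℝ≥0 => ((a * (r : ℝ) ^ 2 - b : ℝ) : EReal)) atTop (𝓝 ⊤) :=
  EReal.tendsto_coe_nhds_top_iff.2 <| tendsto_atTop_add_const_right _ (-b) <|
    ((tendsto_pow_atTop two_ne_zero).comp
      (NNReal.tendsto_coe_atTop.2 tendsto_id)).const_mul_atTop ha

section Compact

variable {X Y : Type*}
  [TopologicalSpace X] [CompactSpace X] [MetrizableSpace X] [MeasurableSpace X] [BorelSpace X]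
  [TopologicalSpace Y] [CompactSpace Y] [MetrizableSpace Y] [MeasurableSpace Y] [BorelSpace Y]
  {φ : ℝ≥0 → ℝ≥0∞} (hφ : IsEntropy φ) {c : (X × Y) × (X × Y) → EReal}
  (μ : Measure X) [IsFiniteMeasure μ] (ν : Measure Y) [IsFiniteMeasure ν]

include hφ

theorem IsEntropy.tendsto_kernelFunctional_cocompact
    (hpos : 0 < 2 * (recession φ : EReal) + ⨅ z, c z) :
    Tendsto (fun π : FiniteMeasure (X × Y) => kernelFunctional φ c μ ν π) (cocompact _) (𝓝 ⊤) := by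
  obtain ⟨m, p, hm, hp, hmp⟩ := hφ.exists_affineMinorant_growth hpos
  exact tendsto_nhds_top_mono' ((tendsto_coe_mul_sq_sub_nhds_top hmp _).comp
    (tendsto_mass_cocompact_atTop (X × Y)))
    fun π => hφ.coe_le_kernelFunctional (le_iInf_iff.1 hm) hp μ ν π

theorem IsEntropy.lowerSemicontinuous_kernelFunctional (hc : LowerSemicontinuous c)
    {m : ℝ} (hm : ∀ z, (m : EReal) ≤ c z) :
    LowerSemicontinuous fun π : FiniteMeasure (X × Y) => kernelFunctional φ c μ ν π := by
  have hcost := (lowerSemicontinuous_integralEReal hc hm).comp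
    (continuous_finiteMeasure_prod.comp (continuous_id.prodMk continuous_id) :
      Continuous fun π : FiniteMeasure (X × Y) => π.prod π)
  have hfst := (hφ.lowerSemicontinuous_quadCsiszar μ).comp
    (FiniteMeasure.continuous_map (Ω := X × Y) continuous_fst)
  have hsnd := (hφ.lowerSemicontinuous_quadCsiszar ν).comp
    (FiniteMeasure.continuous_map (Ω := X × Y) continuous_snd)
  exact lowerSemicontinuous_add_ereal
    (lowerSemicontinuous_add_ereal hcost (lowerSemicontinuous_coe_ennreal_ereal hfst))
    (lowerSemicontinuous_coe_ennreal_ereal hsnd)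

end Compact

theorem bot_lt_iInf_of_lowerSemicontinuous {Z : Type*} [TopologicalSpace Z] [CompactSpace Z]
    {c : Z → EReal} (hc : LowerSemicontinuous c) (hc_bot : ∀ z, c z ≠ ⊥) : ⊥ < ⨅ z, c z := by
  rcases isEmpty_or_nonempty Z with hZ | hZ
  · rw [iInf_of_empty]
    exact bot_lt_top
  · obtain ⟨z, -, hz⟩ := LowerSemicontinuousOn.exists_isMinOn Set.univ_nonempty isCompact_univ
      (hc.lowerSemicontinuousOn Set.univ)
    exact (bot_lt_iff_ne_bot.2 (hc_bot z)).trans_le (le_iInf fun w => hz (Set.mem_univ w))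

theorem lowerSemicontinuous_comp_distortion {X Y : Type*} [MetricSpace X] [MetricSpace Y]
    {lam : ℝ≥0 → EReal} {Δ : ℝ≥0 → ℝ≥0 → ℝ≥0}
    (hlsc : LowerSemicontinuous fun p : ℝ≥0 × ℝ≥0 => lam (Δ p.1 p.2)) :
    LowerSemicontinuous fun z : (X × Y) × (X × Y) => lam (distortion Δ z) :=
  hlsc.comp (g := fun z : (X × Y) × (X × Y) => (nndist z.1.1 z.2.1, nndist z.1.2 z.2.2))
    (by fun_prop)

theorem two_mul_recession_add_iInf_distortion_pos {X Y : Type*}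
    [MetricSpace X] [CompactSpace X] [MetricSpace Y] [CompactSpace Y] {φ : ℝ≥0 → ℝ≥0∞}
    {lam : ℝ≥0 → EReal} {Δ : ℝ≥0 → ℝ≥0 → ℝ≥0} (hlam : ∀ t, lam t ≠ ⊥)
    (hlsc : LowerSemicontinuous fun p : ℝ≥0 × ℝ≥0 => lam (Δ p.1 p.2))
    (h : recession φ = ⊤ ∨ 0 < 2 * (recession φ : EReal) + ⨅ t, lam t) :
    0 < 2 * (recession φ : EReal) + ⨅ z : (X × Y) × (X × Y), lam (distortion Δ z) := by
  rcases h with htop | hpos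
  · have hbot := bot_lt_iInf_of_lowerSemicontinuous
      (lowerSemicontinuous_comp_distortion (X := X) (Y := Y) hlsc) fun z => hlam _
    rw [htop, EReal.coe_ennreal_top, EReal.mul_top_of_pos two_pos,
      EReal.top_add_of_ne_bot hbot.ne']
    exact EReal.zero_lt_top
  · exact hpos.trans_le (add_le_add le_rfl (le_iInf fun z => iInf_le lam _))

end Functional

end UGW

end

theorem mainTheorem5_general {X Y : Type*}
    [TopologicalSpace X] [CompactSpace X] [TopologicalSpace.MetrizableSpace X]
    [MeasurableSpace X] [BorelSpace X]
    [TopologicalSpace Y] [CompactSpace Y] [TopologicalSpace.MetrizableSpace Y]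
    [MeasurableSpace Y] [BorelSpace Y]
    (μ : Measure X) [IsFiniteMeasure μ] (ν : Measure Y) [IsFiniteMeasure ν]
    {φ : ℝ≥0 → ℝ≥0∞} (hφ : UGW.IsEntropy φ)
    {c : (X × Y) × (X × Y) → EReal} (hc : LowerSemicontinuous c)
    (h : 0 < 2 * (UGW.recession φ : EReal) + ⨅ z, c z) :
    ∃ π : FiniteMeasure (X × Y), ∀ π' : FiniteMeasure (X × Y),
      UGW.kernelFunctional φ c μ ν π ≤ UGW.kernelFunctional φ c μ ν π' := by
  obtain ⟨m, -, hm, -⟩ := hφ.exists_affineMinorant_growth h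
  exact UGW.exists_forall_le_of_lowerSemicontinuous
    (hφ.lowerSemicontinuous_kernelFunctional μ ν hc (le_iInf_iff.1 hm))
    (hφ.tendsto_kernelFunctional_cocompact μ ν h)

theorem mainTheorem5 {X Y : Type*}
    [MetricSpace X] [CompactSpace X] [MeasurableSpace X] [BorelSpace X]
    [MetricSpace Y] [CompactSpace Y] [MeasurableSpace Y] [BorelSpace Y]
    (μ : Measure X) [IsFiniteMeasure μ] (ν : Measure Y) [IsFiniteMeasure ν]
    (φ : ℝ≥0 → ℝ≥0∞) (hφ : UGW.IsEntropy φ)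
    (Δ : ℝ≥0 → ℝ≥0 → ℝ≥0) (_hΔ : UGW.IsDistance Δ)
    (lam : ℝ≥0 → EReal) (hlam : ∀ t, lam t ≠ ⊥)
    (hlsc : LowerSemicontinuous (fun p : ℝ≥0 × ℝ≥0 => lam (Δ p.1 p.2)))
    (h : UGW.recession φ = ⊤ ∨
      ((∀ c : ℝ, IsCompact {t : ℝ≥0 | lam t ≤ (c : EReal)}) ∧
        0 < 2 * (UGW.recession φ : EReal) + ⨅ t, lam t)) :
    ∃ π : FiniteMeasure (X × Y),
      UGW.ugw φ lam Δ μ ν = UGW.functional φ lam Δ μ ν (π : Measure (X × Y)) := by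
  obtain ⟨π, hπ⟩ := mainTheorem5_general μ ν hφ (UGW.lowerSemicontinuous_comp_distortion hlsc)
    (UGW.two_mul_recession_add_iInf_distortion_pos hlam hlsc (h.imp_right And.right))
  exact ⟨π, le_antisymm (iInf_le _ π) (le_iInf hπ)⟩
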